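/- Let $X$ be a finite alphabet with at least two letters and $X^*$ the set of finite words over $X$. Automorphisms of the rooted tree $X^*$ are the bijections of $X^*$ that preserve length and prefixes. For such a $g$ and $v\in X^*$ the restriction $g|_v$ is the automorphism with $g(vw)=g(v)\,g|_v(w)$ for all $w\in X^*$; $g$ is called circuit if $g|_v=g$ for some nonempty word $v$. A set $S$ of automorphisms is self-similar if $s|_v\in S$ for all $s\in S$, $v\in X^*$; it is regarded as an automaton with an arrow $s\to s|_x$ labeled $x\,|\,s(x)$ for all $s\in S$, $x\in X$. A finite self-similar set is a polynomial automaton if its different nontrivial simple directed cycles are disjoint (a cycle is trivial if it is a loop at the identity); it has degree $\le m$ if at most $m+1$ different nontrivial cycles are connected by a directed path. $\mathrm{Pol}(m)$ is the set of all states of polynomial automata of degree $\le m$ (so $\mathrm{Pol}(-2)=\emptyset$), and the elements of $\mathrm{Pol}(d)\setminus\mathrm{Pol}(d-1)$ have degree $d$. Logarithms are to base $2$, with the convention $\log 0=\log 1=1$. Let $m\ge -1$ be an integer. (1) Let $G$ be a subgroup of $\mathrm{Pol}(m)$ generated by a finite set $S$, and let $l(g)$ be the length of $g\in G$ with respect to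 $S\cup S^{-1}$. There is a constant $C$ such that for every $g\in G$ and every word $v$ of length $|v|\ge C(\log l(g))^{m+1}$ the restriction $g|_v$ is circuit or belongs to $\mathrm{Pol}(m-1)$. (2) Let $S$ be a finite symmetric self-similar set generating a subgroup of $\mathrm{Pol}(m)$ such that (i) for all $s\in S$ and $x\in X$ the restriction $s|_x$ is circuit or has degree less than the degree of $s$, and (ii) for every nontrivial circuit $s\in S$ there is a letter $x$ with $s|_x=s$. Put $S_{m-1}=S\cap\mathrm{Pol}(m-1)$. For $g=s_1s_2\cdots s_n$ with $s_i\in S$ and $v\in X^*$, the induced presentation of $g|_v$ is $g|_v=s_1|_{v_1}s_2|_{v_2}\cdots s_n|_{v_n}$, where $v_n=v$ and $v_{i-1}=s_i(v_i)$. There is a constant $C$ such that for every $g=s_1s_2\cdots s_n$ with $s_i\in S$ and every word $v$ of length $|v|\ge C(\log n)^{m+1}$ one of the following holds: (a) $g|_v$ belongs to the group generated by $S_{m-1}$, and every factor $s_i|_{v_i}$ of the induced presentation of $g|_v$ belongs to $S_{m-1}$; (b) $g|_v$ is circuit, and there is a letter $x\in X$ such that $(g|_v)|_x=g|_v$ and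 the induced presentations of $g|_v$ and of $(g|_v)|_x=g|_{vx}$ coincide as words in the generators. -/

import Mathlib

open scoped Pointwise

/-! Words over the alphabet `X` (the set `X^*`) are the elements of `List X`. -/

/-- The group of automorphisms of the rooted tree `X^*`: bijections of `X^*` that preserve the
length of words and the relation "is a prefix of". Such automorphisms are the same as the isometries
of the space `X^ω` of infinite words. The product is composition, `(g * h)(v) = g (h v)`. -/
def treeAut (X : Type*) : Subgroup (Equiv.Perm (List X)) where
  carrier := {g | (∀ v, (g v).length = v.length) ∧ ∀ v w, g v <+: g (v ++ w)}
  one_mem' := ⟨fun _ => rfl, fun v w => List.prefix_append v w⟩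
  mul_mem' := by
    rintro g h ⟨hg1, hg2⟩ ⟨hh1, hh2⟩
    refine ⟨fun v => ?_, fun v w => ?_⟩
    · rw [Equiv.Perm.mul_apply, hg1, hh1]
    · rw [Equiv.Perm.mul_apply, Equiv.Perm.mul_apply]
      obtain ⟨t, ht⟩ := hh2 v w
      rw [← ht]
      exact hg2 _ _
  inv_mem' := by
    rintro g ⟨hg1, hg2⟩
    have hl : ∀ v, (g⁻¹ v).length = v.length := fun v => by
      rw [← hg1 (g⁻¹ v)]
      exact congrArg List.length (Equiv.apply_symm_apply g v)
    refine ⟨hl, fun v w => ?_⟩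
    have hs : g (g⁻¹ (v ++ w)) = v ++ w := Equiv.apply_symm_apply g _
    have h := hg2 ((g⁻¹ (v ++ w)).take v.length) ((g⁻¹ (v ++ w)).drop v.length)
    rw [List.take_append_drop, hs] at h
    have hlen : (g ((g⁻¹ (v ++ w)).take v.length)).length = v.length := by
      rw [hg1, List.length_take, hl, List.length_append]
      omega
    have he : g ((g⁻¹ (v ++ w)).take v.length) = v := by
      have h1 := List.prefix_of_prefix_length_le h (List.prefix_append v w) hlen.le
      exact h1.eq_of_length hlen
    have hv : g⁻¹ v = (g⁻¹ (v ++ w)).take v.length := by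
      rw [Equiv.Perm.inv_eq_iff_eq]
      exact he.symm
    rw [hv]
    exact List.take_prefix _ _

/-- The type of automorphisms of the tree `X^*`. -/
abbrev TreeAut (X : Type*) := ↥(treeAut X)

namespace TreeAut

variable {X : Type*}

/-- The image `g(v)` of the word `v` under `g`. -/
def app (g : TreeAut X) (v : List X) : List X := (g : Equiv.Perm (List X)) v

theorem length_app (g : TreeAut X) (v : List X) : (g.app v).length = v.length := g.2.1 v

theorem inv_app_app (g : TreeAut X) (v : List X) : (g⁻¹).app (g.app v) = v :=
  Equiv.symm_apply_apply (g : Equiv.Perm (List X)) v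

theorem app_inv_app (g : TreeAut X) (v : List X) : g.app ((g⁻¹).app v) = v :=
  Equiv.apply_symm_apply (g : Equiv.Perm (List X)) v

theorem app_append (g : TreeAut X) (v w : List X) :
    g.app (v ++ w) = g.app v ++ (g.app (v ++ w)).drop v.length := by
  obtain ⟨t, ht⟩ := g.2.2 v w
  change g.app v ++ t = g.app (v ++ w) at ht
  rw [← ht, ← g.length_app v, List.drop_left]

/-- The restriction (state) `g|_v` of `g` at the word `v`: the unique automorphism with
`g(vw) = g(v) g|_v(w)` for all words `w`. -/
def restr (g : TreeAut X) (v : List X) : TreeAut X :=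
  ⟨{ toFun := fun w => (g.app (v ++ w)).drop v.length
     invFun := fun w => ((g⁻¹).app (g.app v ++ w)).drop v.length
     left_inv := fun w => by
       change ((g⁻¹).app (g.app v ++ (g.app (v ++ w)).drop v.length)).drop v.length = w
       rw [← app_append, inv_app_app, List.drop_left]
     right_inv := fun w => by
       change (g.app (v ++ ((g⁻¹).app (g.app v ++ w)).drop v.length)).drop v.length = w
       have h := app_append g⁻¹ (g.app v) w
       rw [inv_app_app, length_app] at h
       rw [← h, app_inv_app, ← g.length_app v, List.drop_left] },
   by
     refine ⟨fun w => ?_, fun w u => ?_⟩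
     · change ((g.app (v ++ w)).drop v.length).length = w.length
       rw [List.length_drop, length_app, List.length_append]
       omega
     · change (g.app (v ++ w)).drop v.length <+: (g.app (v ++ (w ++ u))).drop v.length
       rw [← List.append_assoc]
       exact (g.2.2 (v ++ w) u).drop _⟩

/-- `g` is circuit: `g|_v = g` for some nonempty word `v`. -/
def IsCircuit (g : TreeAut X) : Prop := ∃ v : List X, v ≠ [] ∧ g.restr v = g

/-- `S` is self-similar: `s|_v ∈ S` for all `s ∈ S` and all words `v`. A (minimized) automaton over
`X` has its states identified with the transformations they define, so it is a self-similar set;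
its arrows are `s → s|_x`, labeled by `x | s(x)`, for `s ∈ S` and `x ∈ X`. -/
def IsSelfSimilar (S : Set (TreeAut X)) : Prop := ∀ s ∈ S, ∀ v : List X, s.restr v ∈ S

/-- `C` is a simple directed cycle, given as its set of arrows, where the arrow from `s` to `s|_x`
with left label `x` is the pair `(s, x)`: the cycle starts at a state `s`, reads a nonempty word `w`
with `s|_w = s`, and the states that it visits before returning to `s` are pairwise different. -/
def IsCycle (C : Set (TreeAut X × X)) : Prop :=
  ∃ (s : TreeAut X) (w : List X), w ≠ [] ∧ s.restr w = s ∧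
    (Function.Injective fun i : Fin w.length => s.restr (w.take i)) ∧
    C = Set.range fun i : Fin w.length => (s.restr (w.take i), w.get i)

/-- The states that lie on a cycle. -/
def cycleStates (C : Set (TreeAut X × X)) : Set (TreeAut X) := Prod.fst '' C

/-- A cycle is trivial if it is a loop at the trivial state. -/
def IsTrivialCycle (C : Set (TreeAut X × X)) : Prop := ∃ x : X, C = {((1 : TreeAut X), x)}

/-- `C` is a nontrivial cycle of the automaton `A`. -/
def IsNontrivialCycleIn (A : Set (TreeAut X)) (C : Set (TreeAut X × X)) : Prop :=
  IsCycle C ∧ cycleStates C ⊆ A ∧ ¬ IsTrivialCycle C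

/-- `A` is a polynomial automaton: a finite automaton in which different nontrivial cycles are
disjoint. -/
def IsPolynomialAutomaton (A : Set (TreeAut X)) : Prop :=
  A.Finite ∧ IsSelfSimilar A ∧
    ∀ C D, IsNontrivialCycleIn A C → IsNontrivialCycleIn A D → C ≠ D →
      Disjoint (cycleStates C) (cycleStates D)

/-- There is a directed path from a state of the cycle `C` to a state of the cycle `D`. -/
def CycleReaches (C D : Set (TreeAut X × X)) : Prop :=
  ∃ s ∈ cycleStates C, ∃ v : List X, s.restr v ∈ cycleStates D

/-- The automaton `A` has degree at most `m`: whenever `k` different nontrivial cycles of `A` are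
connected by a directed path (are visited one after another by it), `k ≤ m + 1`. -/
def HasDegreeLE (A : Set (TreeAut X)) (m : ℤ) : Prop :=
  ∀ L : List (Set (TreeAut X × X)), L.Nodup → (∀ C ∈ L, IsNontrivialCycleIn A C) →
    L.IsChain CycleReaches → (L.length : ℤ) ≤ m + 1

/-- `Pol(m)`: the set of all states of polynomial automata over `X` of degree at most `m`.
It is empty for `m < -1`, and `Pol(-1)` consists of the finitary automorphisms. -/
def Pol (X : Type*) (m : ℤ) : Set (TreeAut X) :=
  {g | ∃ A : Set (TreeAut X), IsPolynomialAutomaton A ∧ HasDegreeLE A m ∧ g ∈ A}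

/-- `g` is a polynomial state of degree `d`. -/
def HasDegree (g : TreeAut X) (d : ℤ) : Prop := g ∈ Pol X d ∧ g ∉ Pol X (d - 1)

/-- The degree of `h` is less than the degree of `g`. -/
def DegreeLT (h g : TreeAut X) : Prop := ∃ d e : ℤ, HasDegree h d ∧ HasDegree g e ∧ d < e

/-- The word length `l_S(g)`: the least number of factors in a product of elements of `S ∪ S⁻¹`
that equals `g` (for `g` in the group generated by `S`). -/
noncomputable def wordLength (S : Set (TreeAut X)) (g : TreeAut X) : ℕ :=
  sInf {n | ∃ L : List (TreeAut X), (∀ s ∈ L, s ∈ S ∪ S⁻¹) ∧ L.length = n ∧ L.prod = g}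

/-- For a presentation `g = s₁ s₂ ⋯ sₙ`, given as the list `[s₁, …, sₙ]`, the induced presentation
`g|_v = s₁|_{v₁} s₂|_{v₂} ⋯ sₙ|_{vₙ}`, where `vₙ = v` and `vᵢ₋₁ = sᵢ(vᵢ)`. -/
def induced : List (TreeAut X) → List X → List (TreeAut X)
  | [], _ => []
  | s :: L, v => s.restr (L.prod.app v) :: induced L v

/-- The conditions on a generating set `S` (which is finite, symmetric and self-similar):
every restriction `s|_x` with `s ∈ S` to a letter `x` is circuit or has degree less than that of `s`,
and for every nontrivial circuit `s ∈ S` there is a letter `x` with `s|_x = s`. -/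
def IsNormalized (S : Set (TreeAut X)) : Prop :=
  S.Finite ∧ S⁻¹ = S ∧ IsSelfSimilar S ∧
    (∀ s ∈ S, ∀ x : X, (s.restr [x]).IsCircuit ∨ DegreeLT (s.restr [x]) s) ∧
    ∀ s ∈ S, s ≠ 1 → s.IsCircuit → ∃ x : X, s.restr [x] = s

end TreeAut

/-- The binary logarithm with the convention `log 0 = log 1 = 1`. -/
noncomputable def binLog (n : ℕ) : ℝ := if n ≤ 1 then 1 else Real.logb 2 n

/-!
Words are read in blocks of `N` letters, where `N` is such that a block takes every generator to a
state that is fixed by some block, or to a state of lower degree. For the normalized sets of the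
second part `N = 1` will do; for the first part, the generators are replaced by the finite set of
all their restrictions, and `N` is a large common multiple of the lengths of its cycles
(`exists_isBlockNormalized`).

The source of all estimates is that a walk which leaves a nontrivial cycle loses degree
(`restr_singleton_mem_Pol_sub_one`). As generators act on blocks by bijections, a product all of
whose factors are fixed by the block `b` has the property that any other block lowers the degrees of
all its factors simultaneously (`induced_lowDegree_of_ne`).

Call a presentation settled if some block fixes all of its factors or all factors have lower degree.
A presentation of length `n` is cut into two halves. Once both halves are settled, reading on either
keeps both fixing blocks, and then they fit together, or lowers the degree of one half. In that case
the half of lower degree reads (or writes) the fixing block of the other half over and over, unless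
that one drops too; by induction on the degree it becomes fixed after `O((log n) ^ (k - 1))`
such blocks (`StabilizesOnConstant`). So each of the `log n` halvings costs `O((log n) ^ (k - 1))`
blocks, and the presentation settles after `O((log n) ^ k)` blocks (`exists_settled`). This is the
second part.

For the first part it remains to see that a product of factors of degree at most `d` has degree at
most `d`, if it is known to be a polynomial state (`prod_mem_lowDegree`). A cycle through such a
product lifts to a cycle of presentations, and a walk that leaves it lowers the degrees of all
factors, which bounds the length of a chain of cycles.
-/

namespace TreeAut

variable {X : Type*}

/-! ### Restrictions and induced presentations -/

theorem ext_app {g h : TreeAut X} (H : ∀ w, g.app w = h.app w) : g = h :=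
  Subtype.ext (Equiv.ext H)

theorem app_append_restr (g : TreeAut X) (v w : List X) :
    g.app (v ++ w) = g.app v ++ (g.restr v).app w :=
  app_append g v w

@[simp] theorem app_one (w : List X) : (1 : TreeAut X).app w = w := rfl

@[simp] theorem app_mul (g h : TreeAut X) (w : List X) : (g * h).app w = g.app (h.app w) := rfl

theorem app_injective (g : TreeAut X) : Function.Injective g.app :=
  (g : Equiv.Perm (List X)).injective

@[simp] theorem app_nil (g : TreeAut X) : g.app [] = [] :=
  List.length_eq_zero_iff.1 (g.length_app [])

theorem restr_eq_of_app {g h : TreeAut X} {v : List X}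
    (H : ∀ w, g.app (v ++ w) = g.app v ++ h.app w) : g.restr v = h :=
  ext_app fun w => List.append_cancel_left ((app_append_restr g v w).symm.trans (H w))

@[simp] theorem restr_nil (g : TreeAut X) : g.restr [] = g :=
  restr_eq_of_app fun w => by simp

@[simp] theorem restr_one (v : List X) : (1 : TreeAut X).restr v = 1 :=
  restr_eq_of_app fun _ => rfl

theorem restr_append (g : TreeAut X) (v w : List X) :
    g.restr (v ++ w) = (g.restr v).restr w :=
  restr_eq_of_app fun u => by
    rw [List.append_assoc, app_append_restr, app_append_restr (g.restr v),
      app_append_restr g v w, List.append_assoc]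

theorem restr_cons (g : TreeAut X) (x : X) (w : List X) :
    g.restr (x :: w) = (g.restr [x]).restr w :=
  restr_append g [x] w

theorem restr_mul (g h : TreeAut X) (v : List X) :
    (g * h).restr v = g.restr (h.app v) * h.restr v :=
  restr_eq_of_app fun w => by
    rw [app_mul, app_mul, app_append_restr h, app_append_restr g, app_mul]

@[simp] theorem induced_nil_right (L : List (TreeAut X)) : induced L [] = L := by
  induction L with
  | nil => rfl
  | cons s L ih => simp [induced, ih]

@[simp] theorem prod_induced (L : List (TreeAut X)) (v : List X) :
    (induced L v).prod = L.prod.restr v := by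
  induction L with
  | nil => simp [induced]
  | cons s L ih => rw [induced, List.prod_cons, List.prod_cons, ih, restr_mul]

@[simp] theorem length_induced (L : List (TreeAut X)) (v : List X) :
    (induced L v).length = L.length := by
  induction L with
  | nil => rfl
  | cons s L ih => simp [induced, ih]

theorem induced_append_right (L : List (TreeAut X)) (v w : List X) :
    induced L (v ++ w) = induced (induced L v) w := by
  induction L with
  | nil => rfl
  | cons s L ih =>
    rw [induced, induced, induced, ih, prod_induced, app_append_restr, restr_append]

theorem induced_append_left (L M : List (TreeAut X)) (v : List X) :
    induced (L ++ M) v = induced L (M.prod.app v) ++ induced M v := by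
  induction L with
  | nil => rfl
  | cons s L ih =>
    rw [List.cons_append, induced, induced, ih, List.cons_append, List.prod_append, app_mul]

/-- The factors of an induced presentation are restrictions of the original factors. -/
theorem forall_mem_induced {T U : Set (TreeAut X)} (H : ∀ s ∈ T, ∀ w : List X, s.restr w ∈ U)
    {L : List (TreeAut X)} (hL : ∀ s ∈ L, s ∈ T) (v : List X) : ∀ t ∈ induced L v, t ∈ U := by
  induction L with
  | nil => simp [induced]
  | cons s L ih =>
    simp only [induced, List.mem_cons, forall_eq_or_imp] at hL ⊢
    exact ⟨H s hL.1 _, ih hL.2⟩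

/-- As `forall_mem_induced`, with control on the length of the words read by the factors. -/
theorem forall_mem_induced_length {T U : Set (TreeAut X)} {n : ℕ}
    (H : ∀ s ∈ T, ∀ w : List X, w.length = n → s.restr w ∈ U)
    {L : List (TreeAut X)} (hL : ∀ s ∈ L, s ∈ T) {v : List X} (hv : v.length = n) :
    ∀ t ∈ induced L v, t ∈ U := by
  induction L with
  | nil => simp [induced]
  | cons s L ih =>
    simp only [induced, List.mem_cons, forall_eq_or_imp] at hL ⊢
    exact ⟨H s hL.1 _ (by rw [length_app, hv]), ih hL.2⟩

/-- The word `b b ⋯ b` with `t` copies of `b`. -/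
def wordPow (b : List X) (t : ℕ) : List X := (List.replicate t b).flatten

@[simp] theorem wordPow_zero (b : List X) : wordPow b 0 = [] := rfl

theorem wordPow_succ (b : List X) (t : ℕ) : wordPow b (t + 1) = b ++ wordPow b t := rfl

@[simp] theorem length_wordPow (b : List X) (t : ℕ) : (wordPow b t).length = b.length * t := by
  simp [wordPow, mul_comm]

theorem restr_wordPow {g : TreeAut X} {b : List X} (h : g.restr b = g) (t : ℕ) :
    g.restr (wordPow b t) = g := by
  induction t with
  | zero => simp
  | succ t ih => rw [wordPow_succ, restr_append, h, ih]

theorem app_wordPow {g : TreeAut X} {b : List X} (h : g.restr b = g) (t : ℕ) :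
    g.app (wordPow b t) = wordPow (g.app b) t := by
  induction t with
  | zero => simp
  | succ t ih => rw [wordPow_succ, app_append_restr, h, ih, wordPow_succ]

theorem restr_prod_of_induced_eq {L : List (TreeAut X)} {b : List X} (h : induced L b = L) :
    L.prod.restr b = L.prod := by
  rw [← prod_induced, h]

theorem induced_wordPow {L : List (TreeAut X)} {b : List X} (h : induced L b = L) (t : ℕ) :
    induced L (wordPow b t) = L := by
  induction t with
  | zero => simp
  | succ t ih => rw [wordPow_succ, induced_append_right, h, ih]

theorem exists_append_of_length {N a c : ℕ} {v : List X} (hv : v.length = N * (a + c)) :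
    ∃ v₁ v₂ : List X, v = v₁ ++ v₂ ∧ v₁.length = N * a ∧ v₂.length = N * c := by
  rw [mul_add] at hv
  refine ⟨v.take (N * a), v.drop (N * a), (List.take_append_drop _ _).symm, ?_, ?_⟩
  · rw [List.length_take]; omega
  · rw [List.length_drop]; omega

/-! ### Cycles of polynomial automata -/

theorem Pol_mono {m n : ℤ} (h : m ≤ n) : Pol X m ⊆ Pol X n := by
  rintro g ⟨A, hA, hd, hg⟩
  exact ⟨A, hA, fun L h1 h2 h3 => (hd L h1 h2 h3).trans (by omega), hg⟩

theorem restr_mem_Pol {m : ℤ} {g : TreeAut X} (hg : g ∈ Pol X m) (v : List X) :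
    g.restr v ∈ Pol X m := by
  obtain ⟨A, hA, hd, hg⟩ := hg
  exact ⟨A, hA, hd, hA.2.1 g hg v⟩

theorem le_of_mem_Pol {m : ℤ} {g : TreeAut X} (hg : g ∈ Pol X m) : -1 ≤ m := by
  obtain ⟨A, hA, hd, hg⟩ := hg
  have := hd [] List.nodup_nil (by simp) List.IsChain.nil
  simp at this
  omega

/-- The set of all states `g|_v` of `g`. -/
def states (g : TreeAut X) : Set (TreeAut X) := Set.range g.restr

theorem mem_states_self (g : TreeAut X) : g ∈ g.states := ⟨[], restr_nil g⟩

theorem isSelfSimilar_states (g : TreeAut X) : IsSelfSimilar g.states := by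
  rintro _ ⟨v, rfl⟩ w
  exact ⟨v ++ w, restr_append g v w⟩

theorem states_subset {A : Set (TreeAut X)} (hA : IsSelfSimilar A) {g : TreeAut X} (hg : g ∈ A) :
    g.states ⊆ A := by
  rintro _ ⟨v, rfl⟩
  exact hA g hg v

theorem finite_states {m : ℤ} {g : TreeAut X} (hg : g ∈ Pol X m) : g.states.Finite := by
  obtain ⟨A, hA, hd, hg⟩ := hg
  exact hA.1.subset (states_subset hA.2.1 hg)

theorem IsNontrivialCycleIn.mono {A B : Set (TreeAut X)} (h : A ⊆ B) {C : Set (TreeAut X × X)}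
    (hC : IsNontrivialCycleIn A C) : IsNontrivialCycleIn B C :=
  ⟨hC.1, hC.2.1.trans h, hC.2.2⟩

theorem IsPolynomialAutomaton.states {A : Set (TreeAut X)} (hA : IsPolynomialAutomaton A)
    {g : TreeAut X} (hg : g ∈ A) : IsPolynomialAutomaton g.states :=
  have h := states_subset hA.2.1 hg
  ⟨hA.1.subset h, isSelfSimilar_states g,
    fun C D hC hD hCD => hA.2.2 C D (hC.mono h) (hD.mono h) hCD⟩

theorem IsCycle.nonempty_states {C : Set (TreeAut X × X)} (hC : IsCycle C) :
    ∃ s, s ∈ cycleStates C := by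
  obtain ⟨s, w, hw, -, -, rfl⟩ := hC
  exact ⟨_, _, ⟨⟨0, List.length_pos_iff.2 hw⟩, rfl⟩, rfl⟩

/-- A closed walk contains a simple cycle that leaves the base point along the same arrow: take a
shortest closed walk with that first letter. -/
theorem exists_isCycle {c : TreeAut X} {x : X} {w : List X} (h : c.restr (x :: w) = c) :
    ∃ C, IsCycle C ∧ cycleStates C ⊆ c.states ∧ (c, x) ∈ C ∧ ∀ y, (c, y) ∈ C → y = x := by
  classical
  have hex : ∃ n, ∃ w : List X, w.length = n ∧ c.restr (x :: w) = c := ⟨_, w, rfl, h⟩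
  obtain ⟨u, hu, huc⟩ := Nat.find_spec hex
  have hmin : ∀ u' : List X, c.restr (x :: u') = c → u.length ≤ u'.length := fun u' hu' => by
    rw [hu]; exact Nat.find_min' hex ⟨u', rfl, hu'⟩
  have hlt : ∀ i j : ℕ, i < j → j < (x :: u).length →
      c.restr ((x :: u).take i) ≠ c.restr ((x :: u).take j) := by
    intro i j hij hj he
    obtain ⟨j, rfl⟩ : ∃ k, j = k + 1 := ⟨j - 1, by omega⟩
    simp only [List.length_cons] at hj
    rcases i with _ | i
    · have := hmin (u.take j) (by simpa using he.symm)
      rw [List.length_take] at this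
      omega
    · have := hmin (u.take i ++ u.drop j) (by
        rw [← List.cons_append, restr_append]
        rw [List.take_succ_cons, List.take_succ_cons] at he
        rw [he, ← restr_append, List.cons_append, List.take_append_drop, huc])
      rw [List.length_append, List.length_take, List.length_drop] at this
      omega
  have hinj : Function.Injective fun i : Fin (x :: u).length => c.restr ((x :: u).take i) := by
    intro i j hij
    rcases lt_trichotomy (i : ℕ) j with h1 | h1 | h1
    · exact absurd hij (hlt _ _ h1 j.2)
    · exact Fin.ext h1
    · exact absurd hij.symm (hlt _ _ h1 i.2)
  refine ⟨_, ⟨c, x :: u, by simp, huc, hinj, rfl⟩, ?_, ⟨0, by simp⟩, ?_⟩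
  · rintro _ ⟨_, ⟨i, rfl⟩, rfl⟩
    exact ⟨_, rfl⟩
  · rintro y ⟨i, hi⟩
    rw [Prod.mk.injEq] at hi
    have : i = ⟨0, by simp⟩ := hinj (by simpa using hi.1)
    rw [← hi.2, this]
    rfl

theorem not_isTrivialCycle {c : TreeAut X} {x : X} {C : Set (TreeAut X × X)} (hc : c ≠ 1)
    (h : (c, x) ∈ C) : ¬ IsTrivialCycle C := by
  rintro ⟨z, rfl⟩
  exact hc (congrArg Prod.fst h)

/-- Leaving a nontrivial cycle lowers the degree: if `c ≠ 1` lies on a closed walk that starts with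
the letter `x`, then no other letter leads back to `c`, so that a chain of cycles that is reachable
from `c|_y` can be prolonged by the cycle through `c`. -/
theorem restr_singleton_mem_Pol_sub_one {c : TreeAut X} {m : ℤ} (hc : c ∈ Pol X m) (hne : c ≠ 1)
    {x y : X} {w : List X} (h : c.restr (x :: w) = c) (hxy : y ≠ x) :
    c.restr [y] ∈ Pol X (m - 1) := by
  obtain ⟨A, hA, hd, hcA⟩ := hc
  obtain ⟨C, hC, hCs, hxC, hCx⟩ := exists_isCycle h
  have hCA : IsNontrivialCycleIn A C :=
    ⟨hC, hCs.trans (states_subset hA.2.1 hcA), not_isTrivialCycle hne hxC⟩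
  have hyA : c.restr [y] ∈ A := hA.2.1 c hcA _
  have hsub : (c.restr [y]).states ⊆ A := states_subset hA.2.1 hyA
  have hnot : c ∉ (c.restr [y]).states := by
    rintro ⟨u, hu⟩
    rw [← restr_cons] at hu
    obtain ⟨D, hD, hDs, hyD, -⟩ := exists_isCycle hu
    have hDA : IsNontrivialCycleIn A D :=
      ⟨hD, hDs.trans (states_subset hA.2.1 hcA), not_isTrivialCycle hne hyD⟩
    have hCD : C ≠ D := fun he => hxy (hCx y (he ▸ hyD))
    exact Set.disjoint_left.1 (hA.2.2 C D hCA hDA hCD) ⟨_, hxC, rfl⟩ ⟨_, hyD, rfl⟩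
  refine ⟨_, hA.states hyA, fun L hL1 hL2 hL3 => ?_, mem_states_self _⟩
  have := hd (C :: L) ?_ ?_ ?_
  · simp only [List.length_cons, Nat.cast_add, Nat.cast_one] at this
    omega
  · exact List.nodup_cons.2 ⟨fun hCL => hnot ((hL2 C hCL).2.1 ⟨_, hxC, rfl⟩), hL1⟩
  · simp only [List.mem_cons, forall_eq_or_imp]
    exact ⟨hCA, fun D hD => (hL2 D hD).mono hsub⟩
  · cases L with
    | nil => exact List.IsChain.singleton _
    | cons D L =>
      refine List.IsChain.cons_cons ?_ hL3
      have hD := hL2 D (by simp)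
      obtain ⟨s, hs⟩ := hD.1.nonempty_states
      obtain ⟨u, hu⟩ := hD.2.1 hs
      exact ⟨c, ⟨_, hxC, rfl⟩, y :: u, by rw [restr_cons, hu]; exact hs⟩

/-- The trivial automorphism together with the states of degree at most `k - 2`. Shifting the index
by two lets it range over `ℕ`; adjoining `1` only matters for `k = 0`, where `Pol (-2)` is empty. -/
def lowDegree (X : Type*) (k : ℕ) : Set (TreeAut X) := insert 1 (Pol X ((k : ℤ) - 2))

theorem lowDegree_mono {j k : ℕ} (h : j ≤ k) : lowDegree X j ⊆ lowDegree X k :=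
  Set.insert_subset_insert (Pol_mono (by omega))

theorem restr_mem_lowDegree {k : ℕ} {g : TreeAut X} (hg : g ∈ lowDegree X k) (v : List X) :
    g.restr v ∈ lowDegree X k := by
  rcases hg with rfl | hg
  · rw [restr_one]; exact Or.inl rfl
  · exact Or.inr (restr_mem_Pol hg v)

theorem eq_one_of_mem_lowDegree_zero {g : TreeAut X} (hg : g ∈ lowDegree X 0) : g = 1 := by
  rcases hg with rfl | hg
  · rfl
  · have := le_of_mem_Pol hg
    norm_num at this

theorem finite_states_of_mem_lowDegree {k : ℕ} {g : TreeAut X} (hg : g ∈ lowDegree X k) :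
    g.states.Finite := by
  rcases hg with rfl | hg
  · refine (Set.finite_singleton (1 : TreeAut X)).subset ?_
    rintro _ ⟨v, rfl⟩
    exact restr_one v
  · exact finite_states hg

theorem restr_singleton_mem_lowDegree {k : ℕ} {c : TreeAut X} (hc : c ∈ lowDegree X (k + 1))
    {x y : X} {w : List X} (h : c.restr (x :: w) = c) (hxy : y ≠ x) :
    c.restr [y] ∈ lowDegree X k := by
  by_cases hne : c = 1
  · subst hne; rw [restr_one]; exact Or.inl rfl
  · refine Or.inr ?_
    have := restr_singleton_mem_Pol_sub_one (hc.resolve_left hne) hne h hxy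
    convert this using 2
    push_cast
    ring

/-- A finitary circuit automorphism is trivial. -/
theorem eq_one_of_isCircuit_of_mem_lowDegree_one [Nontrivial X] {c : TreeAut X}
    (hc : c ∈ lowDegree X 1) (h : c.IsCircuit) : c = 1 := by
  by_contra hne
  obtain ⟨_ | ⟨x, w⟩, hv, hcv⟩ := h
  · exact hv rfl
  obtain ⟨y, hy⟩ := exists_ne x
  have := le_of_mem_Pol (restr_singleton_mem_Pol_sub_one (hc.resolve_left hne) hne hcv hy)
  norm_num at this

/-- A word that branches off a closed walk leads to states of lower degree. -/
theorem restr_mem_lowDegree_of_ne {k : ℕ} {w' : List X} : ∀ {c : TreeAut X} {w z : List X},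
    c ∈ lowDegree X (k + 1) → c.restr (w ++ z) = c → w'.length = w.length → w' ≠ w →
      c.restr w' ∈ lowDegree X k := by
  induction w' with
  | nil =>
    intro c w z _ _ hl hne
    exact absurd (List.length_eq_zero_iff.1 hl.symm).symm hne
  | cons y w' ih =>
    intro c w z hc h hl hne
    obtain _ | ⟨x, w⟩ := w
    · simp at hl
    rw [restr_cons]
    by_cases hxy : y = x
    · subst hxy
      refine ih (w := w) (z := z ++ [y]) (restr_mem_lowDegree hc _) ?_ (by simpa using hl)
        (fun he => hne (by rw [he]))
      rw [← List.append_assoc, ← restr_cons]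
      change c.restr ((y :: w ++ z) ++ [y]) = _
      rw [restr_append, h]
    · exact restr_mem_lowDegree (restr_singleton_mem_lowDegree hc (w := w ++ z) h hxy) _

/-- The same for all factors of a product at once: the letters read by the factors are obtained from
the input by bijections, hence they all leave their closed walks simultaneously. -/
theorem induced_lowDegree_of_ne {k : ℕ} {w w' z : List X} {L : List (TreeAut X)}
    (hL : ∀ s ∈ L, s ∈ lowDegree X (k + 1)) (h : induced L (w ++ z) = L)
    (hl : w'.length = w.length) (hne : w' ≠ w) : ∀ t ∈ induced L w', t ∈ lowDegree X k := by
  induction L with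
  | nil => simp [induced]
  | cons s L ih =>
    rw [induced, List.cons.injEq] at h
    simp only [induced, List.mem_cons, forall_eq_or_imp] at hL ⊢
    rw [app_append_restr] at h
    exact ⟨restr_mem_lowDegree_of_ne hL.1 h.1 (by rw [length_app, length_app, hl])
      (L.prod.app_injective.ne hne), ih hL.2 h.2⟩

/-- A restriction of a circuit state stays on its cycle or has lower degree. -/
theorem IsCircuit.restr_or {k : ℕ} : ∀ {v : List X} {c : TreeAut X}, c ∈ lowDegree X (k + 1) →
    c.IsCircuit → (c.restr v).IsCircuit ∨ c.restr v ∈ lowDegree X k := by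
  intro v
  induction v with
  | nil => intro c _ h; rw [restr_nil]; exact Or.inl h
  | cons y v ih =>
    rintro c hc ⟨_ | ⟨x, w⟩, hw, h⟩
    · exact absurd rfl hw
    rw [restr_cons]
    by_cases hxy : y = x
    · subst hxy
      refine ih (restr_mem_lowDegree hc _) ⟨w ++ [y], by simp, ?_⟩
      rw [restr_append, ← restr_cons, h]
    · exact Or.inr (restr_mem_lowDegree (restr_singleton_mem_lowDegree hc h hxy) _)

/-- In a finite self-similar set, sufficiently long words pass through a repeated state, hence lead
to a circuit state or to a state of lower degree. -/
theorem isCircuit_or_of_card_le {k : ℕ} {T : Finset (TreeAut X)}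
    (hT : IsSelfSimilar (T : Set (TreeAut X))) {s : TreeAut X} (hs : s ∈ T)
    (hk : s ∈ lowDegree X (k + 1)) {w : List X} (hw : T.card ≤ w.length) :
    (s.restr w).IsCircuit ∨ s.restr w ∈ lowDegree X k := by
  obtain ⟨i, hi, j, hj, hij, he⟩ := Finset.exists_ne_map_eq_of_card_lt_of_maps_to
    (s := Finset.range (w.length + 1)) (t := T) (f := fun i => s.restr (w.take i))
    (by simp; omega) (fun i _ => hT s hs _)
  wlog hlt : i < j generalizing i j
  · exact this j hj i hi hij.symm he.symm (by omega)
  rw [← List.take_append_drop i w, restr_append]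
  refine IsCircuit.restr_or (restr_mem_lowDegree hk _) ⟨(w.take j).drop i, ?_, ?_⟩
  · rw [Finset.mem_range] at hj
    rw [← List.length_pos_iff, List.length_drop, List.length_take]
    omega
  · have hti : w.take i = (w.take j).take i := by rw [List.take_take, min_eq_left hlt.le]
    conv_lhs => rw [hti]
    rw [← restr_append, List.take_append_drop]
    exact he.symm

/-! ### Logarithmic stabilization of induced presentations -/

/-- The hypothesis on a set `S` of generators that are read in blocks of `N` letters: a block sends
each generator to a state of lower degree or to one that is fixed by some block. -/
structure IsBlockNormalized (N : ℕ) (S : Set (TreeAut X)) : Prop where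
  selfSimilar : IsSelfSimilar S
  restr_or : ∀ k, ∀ s ∈ S, s ∈ lowDegree X (k + 1) → ∀ w : List X, w.length = N →
    (∃ z : List X, z.length = N ∧ (s.restr w).restr z = s.restr w) ∨ s.restr w ∈ lowDegree X k

/-- All factors of the presentation `L` lie in `lowDegree X k`, or some block of `N` letters fixes
all of them. -/
def Settled (N k : ℕ) (L : List (TreeAut X)) : Prop :=
  (∀ t ∈ L, t ∈ lowDegree X k) ∨ ∃ b : List X, b.length = N ∧ induced L b = L

/-- The input word `u` (for `out = false`) or the output word `g(u)` (for `out = true`). -/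
def port (out : Bool) (g : TreeAut X) (u : List X) : List X := if out then g.app u else u

theorem port_append (out : Bool) (g : TreeAut X) (u v : List X) :
    port out g (u ++ v) = port out g u ++ port out (g.restr u) v := by
  cases out
  · rfl
  · exact app_append_restr g u v

theorem length_port (out : Bool) (g : TreeAut X) (u : List X) :
    (port out g u).length = u.length := by
  cases out
  · rfl
  · exact g.length_app u

theorem port_injective (out : Bool) (g : TreeAut X) : Function.Injective (port out g) := by
  cases out
  · exact fun _ _ h => h
  · exact g.app_injective

theorem port_wordPow (out : Bool) {g : TreeAut X} {b : List X} (h : g.restr b = g) (t : ℕ) :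
    port out g (wordPow b t) = wordPow (port out g b) t := by
  cases out
  · rfl
  · exact app_wordPow h t

theorem induced_lowDegree {k : ℕ} {L : List (TreeAut X)} (hL : ∀ s ∈ L, s ∈ lowDegree X k)
    (v : List X) : ∀ t ∈ induced L v, t ∈ lowDegree X k :=
  forall_mem_induced (fun _ hs => restr_mem_lowDegree hs) hL v

/-- If the block `b` fixes all factors of `L`, then a sequence of blocks other than `b b ⋯ b` lowers
the degree of all factors. -/
theorem eq_wordPow_or_lowDegree {N k : ℕ} {b : List X} (hb : b.length = N)
    {L : List (TreeAut X)} (hL : ∀ s ∈ L, s ∈ lowDegree X (k + 1)) (h : induced L b = L) (t : ℕ) :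
    ∀ {v : List X}, v.length = N * t →
      v = wordPow b t ∨ ∀ s ∈ induced L v, s ∈ lowDegree X k := by
  induction t with
  | zero => intro v hv; exact Or.inl (List.length_eq_zero_iff.1 hv)
  | succ t ih =>
    intro v hv
    obtain ⟨b', v, rfl, hb', hv'⟩ := exists_append_of_length (a := 1) (c := t)
      (by rw [hv, add_comm t])
    rw [mul_one] at hb'
    rw [induced_append_right]
    by_cases hbb : b' = b
    · subst hbb
      rw [h, wordPow_succ]
      exact (ih hv').imp_left fun h' => by rw [h']
    · exact Or.inr (induced_lowDegree
        (induced_lowDegree_of_ne (z := []) hL (by rwa [List.append_nil]) (by rw [hb', hb]) hbb) _)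

theorem Settled.induced {N k : ℕ} {L : List (TreeAut X)}
    (hL : ∀ s ∈ L, s ∈ lowDegree X (k + 1)) (h : Settled N k L) {t : ℕ} {v : List X}
    (hv : v.length = N * t) : Settled N k (induced L v) := by
  rcases h with h | ⟨b, hb, h⟩
  · exact Or.inl (induced_lowDegree h v)
  · rcases eq_wordPow_or_lowDegree hb hL h t hv with rfl | h'
    · rw [induced_wordPow h]
      exact Or.inr ⟨b, hb, h⟩
    · exact Or.inl h'

/-- After a number `B` of blocks, a presentation of length at most `n` with factors in
`lowDegree X k`, when it reads or writes a constant sequence `b b b ⋯` of blocks, is fixed by its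
current input block. -/
def StabilizesOnConstant (N : ℕ) (S : Set (TreeAut X)) (k n B : ℕ) : Prop :=
  ∀ (out : Bool) (L : List (TreeAut X)), (∀ s ∈ L, s ∈ S) → (∀ s ∈ L, s ∈ lowDegree X k) →
    L.length ≤ n → ∀ b : List X, b.length = N → ∀ t, B ≤ t → ∀ v : List X,
      port out L.prod v = wordPow b t →
        ∃ c : List X, c.length = N ∧ induced (induced L v) c = induced L v ∧
          port out (induced L v).prod c = b

/-- After a number `T` of blocks, every presentation of length at most `n` with factors in
`lowDegree X (k + 1)` is settled. -/
def SettlesAfter (N : ℕ) (S : Set (TreeAut X)) (k n T : ℕ) : Prop :=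
  ∀ L : List (TreeAut X), (∀ s ∈ L, s ∈ S) → (∀ s ∈ L, s ∈ lowDegree X (k + 1)) →
    L.length ≤ n → ∀ t, T ≤ t → ∀ v : List X, v.length = N * t → Settled N k (induced L v)

/-- If one of two settled presentations has low degree, then their concatenation settles while the
low part reads or writes the fixing block of the other part. -/
theorem Settled.append_of_lowDegree {N k n B : ℕ} {S : Set (TreeAut X)}
    (hQ : StabilizesOnConstant N S k n B) {L M : List (TreeAut X)}
    (hL : ∀ s ∈ L, s ∈ S) (hM : ∀ s ∈ M, s ∈ S)
    (hLk : ∀ s ∈ L, s ∈ lowDegree X (k + 1)) (hMk : ∀ s ∈ M, s ∈ lowDegree X (k + 1))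
    (hLn : L.length ≤ n) (hMn : M.length ≤ n) (hLs : Settled N k L) (hMs : Settled N k M)
    (hor : (∀ s ∈ L, s ∈ lowDegree X k) ∨ ∀ s ∈ M, s ∈ lowDegree X k)
    {t : ℕ} (ht : B ≤ t) {v : List X} (hv : v.length = N * t) :
    Settled N k (TreeAut.induced (L ++ M) v) := by
  have hlow : ∀ {L M : List (TreeAut X)}, (∀ s ∈ L, s ∈ lowDegree X k) →
      (∀ s ∈ M, s ∈ lowDegree X k) → Settled N k (L ++ M) := fun h1 h2 =>
    Or.inl fun s hs => (List.mem_append.1 hs).elim (h1 s) (h2 s)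
  rw [induced_append_left]
  rcases hor with hlowL | hlowM
  · rcases hMs with hlowM | ⟨b, hb, hMb⟩
    · exact hlow (induced_lowDegree hlowL _) (induced_lowDegree hlowM _)
    rcases eq_wordPow_or_lowDegree hb hMk hMb t hv with rfl | hlowM
    · rw [induced_wordPow hMb, app_wordPow (restr_prod_of_induced_eq hMb)]
      obtain ⟨c, hc, hLc, rfl⟩ := hQ false L hL hlowL hLn (M.prod.app b)
        (by rw [length_app, hb]) t ht _ rfl
      exact Or.inr ⟨b, hb, by rw [induced_append_left, hMb]; exact congrArg (· ++ M) hLc⟩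
    · exact hlow (induced_lowDegree hlowL _) hlowM
  · rcases hLs with hlowL | ⟨b, hb, hLb⟩
    · exact hlow (induced_lowDegree hlowL _) (induced_lowDegree hlowM _)
    rcases eq_wordPow_or_lowDegree hb hLk hLb t (v := M.prod.app v) (by rw [length_app, hv])
      with hvb | hlowL
    · obtain ⟨c, hc, hMc, hcb⟩ := hQ true M hM hlowM hMn b hb t ht v hvb
      change (TreeAut.induced M v).prod.app c = b at hcb
      refine Or.inr ⟨c, hc, ?_⟩
      rw [hvb, induced_wordPow hLb, induced_append_left, hMc, hcb, hLb]
    · exact hlow hlowL (induced_lowDegree hlowM _)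

/-- Two settled presentations are settled together after `2 * B` further blocks: in the first half,
either both fixing blocks persist, or one of the two parts drops to low degree. -/
theorem Settled.append {N k n B : ℕ} (hB : 1 ≤ B) {S : Set (TreeAut X)} (hS : IsSelfSimilar S)
    (hQ : StabilizesOnConstant N S k n B) {L M : List (TreeAut X)}
    (hL : ∀ s ∈ L, s ∈ S) (hM : ∀ s ∈ M, s ∈ S)
    (hLk : ∀ s ∈ L, s ∈ lowDegree X (k + 1)) (hMk : ∀ s ∈ M, s ∈ lowDegree X (k + 1))
    (hLn : L.length ≤ n) (hMn : M.length ≤ n) (hLs : Settled N k L) (hMs : Settled N k M)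
    {t : ℕ} (ht : 2 * B ≤ t) {v : List X} (hv : v.length = N * t) :
    Settled N k (TreeAut.induced (L ++ M) v) := by
  by_cases hor : (∀ s ∈ L, s ∈ lowDegree X k) ∨ ∀ s ∈ M, s ∈ lowDegree X k
  · exact append_of_lowDegree hQ hL hM hLk hMk hLn hMn hLs hMs hor (by omega) hv
  rw [not_or] at hor
  obtain ⟨b, hb, hLb⟩ := hLs.resolve_left hor.1
  obtain ⟨c, hc, hMc⟩ := hMs.resolve_left hor.2
  obtain ⟨r, rfl⟩ : ∃ r, t = B + r := ⟨t - B, by omega⟩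
  obtain ⟨v, u, rfl, hv, hu⟩ := exists_append_of_length hv
  have hv' : (M.prod.app v).length = N * B := by rw [length_app, hv]
  have hLs' := hLs.induced hLk hv'
  have hMs' := hMs.induced hMk hv
  have key : ((∀ s ∈ TreeAut.induced L (M.prod.app v), s ∈ lowDegree X k) ∨
      ∀ s ∈ TreeAut.induced M v, s ∈ lowDegree X k) →
      Settled N k (TreeAut.induced (L ++ M) (v ++ u)) := fun hor' => by
    rw [induced_append_right, induced_append_left]
    exact append_of_lowDegree hQ (forall_mem_induced hS hL _) (forall_mem_induced hS hM _)
      (induced_lowDegree hLk _) (induced_lowDegree hMk _) (by rwa [length_induced])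
      (by rwa [length_induced]) hLs' hMs' hor' (by omega) hu
  rcases eq_wordPow_or_lowDegree hc hMk hMc B hv with rfl | hlow
  · rcases eq_wordPow_or_lowDegree hb hLk hLb B hv' with hvb | hlow
    · have hcb : M.prod.app c = b := by
        obtain ⟨B, rfl⟩ : ∃ B', B = B' + 1 := ⟨B - 1, by omega⟩
        rw [app_wordPow (restr_prod_of_induced_eq hMc), wordPow_succ, wordPow_succ] at hvb
        exact (List.append_inj hvb (by rw [length_app, hb, hc])).1
      have hst : TreeAut.induced (L ++ M) c = L ++ M := by
        rw [induced_append_left, hcb, hLb, hMc]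
      rw [induced_append_right, induced_wordPow hst]
      refine Settled.induced (fun s hs => (List.mem_append.1 hs).elim (hLk s) (hMk s))
        (Or.inr ⟨c, hc, hst⟩) hu
    · exact key (Or.inl hlow)
  · exact key (Or.inr hlow)

/-- Halving a presentation and combining the halves with `Settled.append` settles it in a
logarithmic number of rounds. -/
theorem SettlesAfter.of_stabilizesOnConstant {N k B : ℕ} (hB : 1 ≤ B) {S : Set (TreeAut X)}
    (hS : IsBlockNormalized N S) {l : ℕ} (hQ : StabilizesOnConstant N S k (2 ^ l) B) :
    ∀ i ≤ l, SettlesAfter N S k (2 ^ i) (1 + 2 * i * B) := by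
  intro i
  induction i with
  | zero =>
    intro _ L hL hLk hLn t ht v hv
    obtain ⟨t, rfl⟩ : ∃ r, t = 1 + r := ⟨t - 1, by omega⟩
    obtain ⟨w, v, rfl, hw, hv⟩ := exists_append_of_length hv
    rw [mul_one] at hw
    rw [induced_append_right]
    refine Settled.induced (induced_lowDegree hLk _) ?_ hv
    rcases L with _ | ⟨s, _ | ⟨s', L⟩⟩
    · exact Or.inl (by simp [TreeAut.induced])
    · simp only [List.mem_singleton, forall_eq] at hL hLk
      rcases hS.restr_or k s hL hLk w hw with ⟨z, hz, hsz⟩ | hlow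
      · exact Or.inr ⟨z, hz, by simp [TreeAut.induced, hsz]⟩
      · exact Or.inl (by simpa [TreeAut.induced] using hlow)
    · simp at hLn
  | succ i ih =>
    intro hil L hL hLk hLn t ht v hv
    have hpow : 2 ^ i ≤ 2 ^ l := Nat.pow_le_pow_right (by norm_num) (by omega)
    rw [show 1 + 2 * (i + 1) * B = 1 + 2 * i * B + 2 * B by ring] at ht
    obtain ⟨r, rfl⟩ : ∃ r, t = (1 + 2 * i * B) + r := ⟨t - (1 + 2 * i * B), by omega⟩
    obtain ⟨v, u, rfl, hv, hu⟩ := exists_append_of_length hv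
    rw [pow_succ] at hLn
    rw [← List.take_append_drop (2 ^ i) L, induced_append_right, induced_append_left]
    have hL₁ : ∀ s ∈ L.take (2 ^ i), s ∈ L := fun s hs => List.mem_of_mem_take hs
    have hL₂ : ∀ s ∈ L.drop (2 ^ i), s ∈ L := fun s hs => List.mem_of_mem_drop hs
    have hn₁ : (L.take (2 ^ i)).length ≤ 2 ^ i := by rw [List.length_take]; exact min_le_left _ _
    have hn₂ : (L.drop (2 ^ i)).length ≤ 2 ^ i := by rw [List.length_drop]; omega
    generalize L.take (2 ^ i) = L₁ at *
    generalize L.drop (2 ^ i) = L₂ at *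
    exact Settled.append hB hS.selfSimilar hQ
      (forall_mem_induced hS.selfSimilar (fun s hs => hL s (hL₁ s hs)) _)
      (forall_mem_induced hS.selfSimilar (fun s hs => hL s (hL₂ s hs)) _)
      (induced_lowDegree (fun s hs => hLk s (hL₁ s hs)) _)
      (induced_lowDegree (fun s hs => hLk s (hL₂ s hs)) _)
      (by rw [length_induced]; exact hn₁.trans hpow) (by rw [length_induced]; exact hn₂.trans hpow)
      (ih (by omega) L₁ (fun s hs => hL s (hL₁ s hs)) (fun s hs => hLk s (hL₁ s hs)) hn₁ _ le_rfl _
        (by rw [length_app, hv]))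
      (ih (by omega) L₂ (fun s hs => hL s (hL₂ s hs)) (fun s hs => hLk s (hL₂ s hs)) hn₂ _ le_rfl _
        hv)
      (by omega) hu

/-- Once a presentation that reads or writes a constant sequence of blocks is settled, one further
block shows whether its fixing block agrees with the constant one; if not, its degree drops. -/
theorem StabilizesOnConstant.succ {N k n B T : ℕ} {S : Set (TreeAut X)} (hS : IsSelfSimilar S)
    (hQ : StabilizesOnConstant N S k n B) (hP : SettlesAfter N S k n T) :
    StabilizesOnConstant N S (k + 1) n (T + (1 + B)) := by
  intro out L hL hLk hLn b hb t ht v hv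
  obtain ⟨r, rfl⟩ : ∃ r, t = T + (1 + r) := ⟨t - T - 1, by omega⟩
  have hvl := congrArg List.length hv
  rw [length_port, length_wordPow, hb] at hvl
  obtain ⟨v, u, rfl, hvl, hul⟩ := exists_append_of_length hvl
  have hsplit : port out L.prod v = wordPow b T ∧
      port out (L.prod.restr v) u = wordPow b (1 + r) := by
    rw [port_append, wordPow, List.replicate_add, List.flatten_append] at hv
    exact List.append_inj hv (by rw [length_port, hvl]; simp [hb])
  have hs := hP L hL hLk hLn T le_rfl v hvl
  rw [← prod_induced] at hsplit
  rw [induced_append_right]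
  have hL' := forall_mem_induced hS hL v
  have hLk' := induced_lowDegree hLk v
  have hLn' : (induced L v).length ≤ n := by rwa [length_induced]
  replace hv := hsplit.2
  clear hsplit
  generalize induced L v = M at *
  rcases hs with hlow | ⟨c, hc, hMc⟩
  · exact hQ out M hL' hlow hLn' b hb (1 + r) (by omega) u hv
  obtain ⟨c', u, rfl, hc', hul'⟩ := exists_append_of_length hul
  rw [mul_one] at hc'
  have hsplit : port out M.prod c' = b ∧
      port out (M.prod.restr c') u = wordPow b r := by
    rw [port_append, add_comm 1 r, wordPow_succ] at hv
    exact List.append_inj hv (by rw [length_port, hb, hc'])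
  by_cases hcc : c' = c
  · subst hcc
    rw [restr_prod_of_induced_eq hMc] at hsplit
    have hu : u = wordPow c' r := port_injective out M.prod (by
      rw [hsplit.2, port_wordPow out (restr_prod_of_induced_eq hMc), hsplit.1])
    rw [induced_append_right, hMc, hu, induced_wordPow hMc]
    exact ⟨c', hc, hMc, hsplit.1⟩
  · rw [induced_append_right]
    refine hQ out _ (forall_mem_induced hS hL' c') ?_ (by rwa [length_induced]) b hb r (by omega) u
      (by rw [prod_induced]; exact hsplit.2)
    exact induced_lowDegree_of_ne (z := []) hLk' (by rwa [List.append_nil]) (by rw [hc, hc']) hcc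

/-- The number of blocks after which presentations of length at most `2 ^ l` and degree at most
`k - 1` stabilize; it is a polynomial in `l` of degree `k`. -/
def blockBound (l : ℕ) : ℕ → ℕ
  | 0 => 2
  | k + 1 => 2 + (2 * l + 1) * blockBound l k

theorem one_le_blockBound (l k : ℕ) : 1 ≤ blockBound l k := by
  cases k with
  | zero => exact one_le_two
  | succ k => rw [blockBound]; omega

theorem blockBound_le {l : ℕ} (hl : 1 ≤ l) (k : ℕ) : blockBound l k ≤ 2 * (4 * l) ^ k := by
  induction k with
  | zero => simp [blockBound]
  | succ k ih =>
    have h1 : 1 ≤ (4 * l) ^ k := Nat.one_le_pow _ _ (by omega)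
    rw [blockBound, pow_succ]
    nlinarith

theorem isCircuit_of_restr_eq {N : ℕ} (hN : 0 < N) {g : TreeAut X} {z : List X}
    (hz : z.length = N) (h : g.restr z = g) : g.IsCircuit :=
  ⟨z, by rw [← List.length_pos_iff]; omega, h⟩

theorem settlesAfter_zero [Nontrivial X] {N : ℕ} (hN : 0 < N) {S : Set (TreeAut X)}
    (hS : IsBlockNormalized N S) (n : ℕ) : SettlesAfter N S 0 n 1 := by
  intro L hL hLk hLn t ht v hv
  obtain ⟨t, rfl⟩ : ∃ r, t = 1 + r := ⟨t - 1, by omega⟩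
  obtain ⟨w, v, rfl, hw, hv⟩ := exists_append_of_length hv
  rw [mul_one] at hw
  rw [induced_append_right]
  refine Or.inl (induced_lowDegree (forall_mem_induced_length (T := S ∩ lowDegree X 1)
    (fun s hs w hw => ?_) (fun s hs => ⟨hL s hs, hLk s hs⟩) hw) v)
  -- Finitary circuit generators are trivial, so one block already makes all factors trivial.
  rcases hS.restr_or 0 s hs.1 hs.2 w hw with ⟨z, hz, hsz⟩ | h
  · exact Or.inl (eq_one_of_isCircuit_of_mem_lowDegree_one (restr_mem_lowDegree hs.2 w)
      (isCircuit_of_restr_eq hN hz hsz))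
  · exact h

theorem induced_eq_of_lowDegree_zero {L : List (TreeAut X)} (hL : ∀ s ∈ L, s ∈ lowDegree X 0)
    (v : List X) : induced L v = L := by
  induction L with
  | nil => rfl
  | cons s L ih =>
    simp only [List.mem_cons, forall_eq_or_imp] at hL
    rw [induced, ih hL.2, eq_one_of_mem_lowDegree_zero hL.1, restr_one]

theorem stabilizesOnConstant_zero (N : ℕ) (S : Set (TreeAut X)) (n : ℕ) :
    StabilizesOnConstant N S 0 n 0 := by
  intro out L hL hLk hLn b hb t ht v hv
  have hprod : L.prod = 1 := List.prod_eq_one fun s hs => eq_one_of_mem_lowDegree_zero (hLk s hs)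
  rw [induced_eq_of_lowDegree_zero hLk]
  refine ⟨b, hb, induced_eq_of_lowDegree_zero hLk b, ?_⟩
  rw [hprod]
  cases out <;> rfl

theorem stabilizesOnConstant [Nontrivial X] {N : ℕ} (hN : 0 < N) {S : Set (TreeAut X)}
    (hS : IsBlockNormalized N S) (l k : ℕ) :
    StabilizesOnConstant N S (k + 1) (2 ^ l) (blockBound l k) := by
  induction k with
  | zero => exact (stabilizesOnConstant_zero N S _).succ hS.selfSimilar (settlesAfter_zero hN hS _)
  | succ k ih =>
    have := ih.succ hS.selfSimilar
      (.of_stabilizesOnConstant (one_le_blockBound l k) hS ih l le_rfl)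
    rwa [show 1 + 2 * l * blockBound l k + (1 + blockBound l k) = blockBound l (k + 1) by
      rw [blockBound]; ring] at this

theorem settlesAfter [Nontrivial X] {N : ℕ} (hN : 0 < N) {S : Set (TreeAut X)}
    (hS : IsBlockNormalized N S) (l k : ℕ) : SettlesAfter N S k (2 ^ l) (blockBound l k) := by
  intro L hL hLk hLn t ht
  cases k with
  | zero => exact settlesAfter_zero hN hS _ L hL hLk hLn t ((one_le_blockBound l 0).trans ht)
  | succ k =>
    refine SettlesAfter.of_stabilizesOnConstant (one_le_blockBound l k) hS
      (stabilizesOnConstant hN hS l k) l le_rfl L hL hLk hLn t (le_trans ?_ ht)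
    rw [blockBound]
    nlinarith

/-- A presentation of length `n` over a block-normalized set settles while it reads a word of length
at least a constant times `(log n) ^ k`, before the incomplete block `v₂` at its end. -/
theorem exists_settled [Nontrivial X] {N : ℕ} (hN : 0 < N) {S : Set (TreeAut X)}
    (hS : IsBlockNormalized N S) (k : ℕ) (hSk : S ⊆ lowDegree X (k + 1)) :
    ∃ C : ℝ, ∀ L : List (TreeAut X), (∀ s ∈ L, s ∈ S) → ∀ v : List X,
      C * binLog L.length ^ k ≤ (v.length : ℝ) →
        ∃ v₁ v₂ : List X, v = v₁ ++ v₂ ∧ v₂.length < N ∧ Settled N k (induced L v₁) := by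
  refine ⟨N * (2 * 8 ^ k), fun L hL v hv => ?_⟩
  set n := L.length
  have hlog : 1 ≤ binLog n ∧ (Nat.log 2 n : ℝ) ≤ binLog n := by
    rw [binLog]
    split_ifs with h
    · rw [Nat.log_of_lt (by omega)]; norm_num
    · have h2 : (1 : ℝ) ≤ Real.logb 2 n := by
        rw [Real.le_logb_iff_rpow_le one_lt_two (by exact_mod_cast (by omega : 0 < n)),
          Real.rpow_one]
        exact_mod_cast (by omega : 2 ≤ n)
      exact ⟨h2, Real.natLog_le_logb n 2⟩
  set l := Nat.log 2 n + 1 with hl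
  have hlR : (l : ℝ) ≤ 2 * binLog n := by rw [hl]; push_cast; linarith [hlog.1, hlog.2]
  have hbound : N * blockBound l k ≤ v.length := by
    have h1 : (blockBound l k : ℝ) ≤ 2 * (4 * l) ^ k := by
      exact_mod_cast blockBound_le (by omega : 1 ≤ l) k
    have h2 : (4 * (l : ℝ)) ^ k ≤ 8 ^ k * binLog n ^ k := by
      rw [← mul_pow]
      exact pow_le_pow_left₀ (by positivity) (by linarith) k
    have h3 : 0 ≤ binLog n ^ k := pow_nonneg (by linarith [hlog.1]) k
    have h4 : (N : ℝ) * blockBound l k ≤ v.length := by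
      refine le_trans ?_ hv
      rw [mul_assoc]
      refine mul_le_mul_of_nonneg_left ?_ (Nat.cast_nonneg N)
      nlinarith
    exact_mod_cast h4
  have hdiv := Nat.div_add_mod v.length N
  have hmod := Nat.mod_lt v.length hN
  refine ⟨v.take (N * (v.length / N)), v.drop (N * (v.length / N)),
    (List.take_append_drop _ _).symm, ?_, ?_⟩
  · rw [List.length_drop]; omega
  · refine settlesAfter hN hS l k L hL (fun s hs => hSk (hL s hs)) ?_ (v.length / N) ?_ _ ?_
    · exact (Nat.lt_pow_succ_log_self one_lt_two n).le
    · rw [Nat.le_div_iff_mul_le hN, mul_comm]; exact hbound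
    · rw [List.length_take]; omega

/-! ### Products of states of low degree -/

theorem IsCycle.exists_restr_eq {C : Set (TreeAut X × X)} (hC : IsCycle C) {s t : TreeAut X}
    (hs : s ∈ cycleStates C) (ht : t ∈ cycleStates C) : ∃ v : List X, s.restr v = t := by
  obtain ⟨c, w, -, hcw, -, rfl⟩ := hC
  obtain ⟨_, ⟨i, rfl⟩, rfl⟩ := hs
  obtain ⟨_, ⟨j, rfl⟩, rfl⟩ := ht
  refine ⟨w.drop i ++ w.take j, ?_⟩
  rw [← restr_append, ← List.append_assoc, List.take_append_drop, restr_append, hcw]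

/-- A state of a cycle has an outgoing arrow that stays on the cycle and starts a closed walk. -/
theorem IsCycle.exists_arrow {C : Set (TreeAut X × X)} (hC : IsCycle C) {s : TreeAut X}
    (hs : s ∈ cycleStates C) :
    ∃ (x : X) (w : List X), s.restr (x :: w) = s ∧ s.restr [x] ∈ cycleStates C := by
  have hC' := hC
  obtain ⟨c, w, hw, hcw, -, rfl⟩ := hC
  obtain ⟨_, ⟨i, rfl⟩, rfl⟩ := id hs
  have hmem : (c.restr (w.take i)).restr [w.get i] ∈
      cycleStates (Set.range fun i : Fin w.length => (c.restr (w.take i), w.get i)) := by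
    rw [← restr_append, List.get_eq_getElem, List.take_append_getElem]
    by_cases hi : (i : ℕ) + 1 < w.length
    · exact ⟨_, ⟨⟨i + 1, hi⟩, rfl⟩, rfl⟩
    · rw [List.take_of_length_le (by omega), hcw]
      exact ⟨_, ⟨⟨0, List.length_pos_iff.2 hw⟩, rfl⟩, by simp⟩
  obtain ⟨u, hu⟩ := hC'.exists_restr_eq hmem hs
  exact ⟨w.get i, u, by rw [restr_cons, hu], hmem⟩

theorem IsCycle.isCircuit {C : Set (TreeAut X × X)} (hC : IsCycle C) {s : TreeAut X}
    (hs : s ∈ cycleStates C) : s.IsCircuit := by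
  obtain ⟨x, w, h, -⟩ := hC.exists_arrow hs
  exact ⟨x :: w, by simp, h⟩

theorem IsCycle.isTrivialCycle {C : Set (TreeAut X × X)} (hC : IsCycle C)
    (h : (1 : TreeAut X) ∈ cycleStates C) : IsTrivialCycle C := by
  have hC' := hC
  obtain ⟨c, w, hw, hcw, hinj, rfl⟩ := hC
  obtain ⟨u, hu⟩ := hC'.exists_restr_eq (t := c) h
    ⟨_, ⟨⟨0, List.length_pos_iff.2 hw⟩, rfl⟩, by simp⟩
  rw [restr_one] at hu
  subst hu
  have hsub : ∀ i j : Fin w.length, i = j := fun i j => hinj (by simp)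
  have hpos := List.length_pos_iff.2 hw
  refine ⟨w.get ⟨0, hpos⟩, Set.eq_singleton_iff_unique_mem.2 ⟨⟨⟨0, hpos⟩, by simp⟩, ?_⟩⟩
  rintro _ ⟨i, rfl⟩
  rw [hsub i ⟨0, hpos⟩]
  simp

theorem one_mem_Pol {m : ℤ} (hm : -1 ≤ m) : (1 : TreeAut X) ∈ Pol X m := by
  have hno : ∀ C, ¬ IsNontrivialCycleIn ({1} : Set (TreeAut X)) C := by
    rintro C ⟨hC, hC1, hCt⟩
    obtain ⟨s, hs⟩ := hC.nonempty_states
    obtain rfl : s = 1 := hC1 hs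
    exact hCt (hC.isTrivialCycle hs)
  refine ⟨{1}, ⟨Set.finite_singleton _, ?_, fun C _ hC => absurd hC (hno C)⟩, ?_, rfl⟩
  · rintro _ rfl v
    exact restr_one v
  · rintro (_ | ⟨C, L⟩) - hL -
    · simpa using by omega
    · exact absurd (hL C (by simp)) (hno C)

/-- A walk that leaves the set `T` has a last state in `T` before its first exit. -/
theorem exists_exit {T : Set (TreeAut X)} : ∀ {v : List X} {s : TreeAut X}, s ∈ T →
    s.restr v ∉ T → ∃ (p : List X) (y : X) (r : List X), v = p ++ y :: r ∧ s.restr p ∈ T ∧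
      (s.restr p).restr [y] ∉ T := by
  intro v
  induction v with
  | nil => intro s hs h; rw [restr_nil] at h; exact absurd hs h
  | cons y v ih =>
    intro s hs h
    by_cases hy : s.restr [y] ∈ T
    · rw [restr_cons] at h
      obtain ⟨p, z, r, rfl, hp, hz⟩ := ih hy h
      exact ⟨y :: p, z, r, rfl, by rwa [restr_cons], by rwa [restr_cons s y p]⟩
    · exact ⟨[], y, v, rfl, by rwa [restr_nil], by rwa [restr_nil]⟩

theorem finite_range_induced {L : List (TreeAut X)} (hL : ∀ s ∈ L, s.states.Finite) :
    (Set.range (induced L)).Finite := by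
  induction L with
  | nil => exact (Set.finite_singleton []).subset (by rintro _ ⟨v, rfl⟩; rfl)
  | cons s L ih =>
    simp only [List.mem_cons, forall_eq_or_imp] at hL
    refine (hL.1.image2 List.cons (ih hL.2)).subset ?_
    rintro _ ⟨v, rfl⟩
    exact ⟨_, ⟨_, rfl⟩, _, ⟨_, rfl⟩, rfl⟩

/-- A circuit product has a presentation that is fixed by a power of its closed walk. -/
theorem exists_induced_wordPow_eq {k : ℕ} {L : List (TreeAut X)}
    (hL : ∀ s ∈ L, s ∈ lowDegree X k) {u : List X} (hu : L.prod.restr u = L.prod) :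
    ∃ (M : List (TreeAut X)) (j : ℕ), (∀ s ∈ M, s ∈ lowDegree X k) ∧ M.prod = L.prod ∧
      induced M (wordPow u (j + 1)) = M := by
  obtain ⟨a, b, hab, he⟩ := (finite_range_induced fun s hs =>
    finite_states_of_mem_lowDegree (hL s hs)).exists_lt_map_eq_of_forall_mem
      (f := fun i : ℕ => induced L (wordPow u i)) (fun i => Set.mem_range_self _)
  obtain ⟨j, rfl⟩ : ∃ j, b = a + (j + 1) := ⟨b - a - 1, by omega⟩
  refine ⟨_, j, induced_lowDegree hL (wordPow u a), ?_, ?_⟩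
  · rw [prod_induced, restr_wordPow hu]
  · rw [← induced_append_right]
    refine Eq.trans (congrArg _ ?_) he.symm
    simp [wordPow, -List.replicate_append_replicate, List.replicate_add]

/-- A product of finitary automorphisms that is circuit is trivial. -/
theorem prod_eq_one_of_isCircuit [Nontrivial X] {L : List (TreeAut X)}
    (hL : ∀ s ∈ L, s ∈ lowDegree X 1) (h : L.prod.IsCircuit) : L.prod = 1 := by
  obtain ⟨u, hu, hLu⟩ := h
  obtain ⟨M, j, hM, hML, hMu⟩ := exists_induced_wordPow_eq hL hLu
  rw [← hML]
  refine List.prod_eq_one fun s hs => eq_one_of_isCircuit_of_mem_lowDegree_one (hM s hs) ?_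
  have hpos : 0 < (wordPow u (j + 1)).length := by
    rw [length_wordPow]
    exact Nat.mul_pos (List.length_pos_iff.2 hu) (by omega)
  generalize wordPow u (j + 1) = w at hMu hpos
  clear hML hM
  induction M with
  | nil => simp at hs
  | cons t M ih =>
    rw [induced, List.cons.injEq] at hMu
    rcases List.mem_cons.1 hs with rfl | hs
    · exact ⟨_, by rw [← List.length_pos_iff, length_app]; exact hpos, hMu.1⟩
    · exact ih hs hMu.2

/-- Cycles reachable from a product of states of degree at most `k - 2` form chains of length at
most `k - 1`: when the walk leaves the first cycle, the degrees of all factors drop. -/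
theorem length_chain_le [Nontrivial X] {A : Set (TreeAut X)} (hA : IsPolynomialAutomaton A)
    (Cs : List (Set (TreeAut X × X))) : ∀ (k : ℕ) (C : Set (TreeAut X × X))
    (L : List (TreeAut X)), (∀ s ∈ L, s ∈ lowDegree X k) → (C :: Cs).Nodup →
    (∀ D ∈ C :: Cs, IsNontrivialCycleIn A D) → (C :: Cs).IsChain CycleReaches →
    (∃ v, L.prod.restr v ∈ cycleStates C) → Cs.length + 2 ≤ k := by
  induction Cs with
  | nil =>
    rintro k C L hL - hC - ⟨v, hv⟩
    by_contra hk
    simp only [List.length_nil, zero_add, not_le] at hk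
    have hCA := hC C (by simp)
    refine hCA.2.2 (hCA.1.isTrivialCycle ?_)
    rw [← prod_induced] at hv
    rwa [prod_eq_one_of_isCircuit (fun s hs => lowDegree_mono (by omega : k ≤ 1)
      (induced_lowDegree hL v s hs)) (hCA.1.isCircuit hv)] at hv
  | cons D Cs ih =>
    rintro k C L hL hnd hC hch ⟨v, hv⟩
    have hCA := hC C (by simp)
    have hDA := hC D (by simp)
    rw [List.isChain_cons_cons] at hch
    obtain ⟨⟨s, hs, z, hz⟩, hch⟩ := hch
    rw [List.nodup_cons] at hnd
    have hCD : C ≠ D := fun he => hnd.1 (by simp [he])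
    obtain ⟨p, y, r, rfl, hp, hy⟩ := exists_exit hs
      (Set.disjoint_right.1 (hA.2.2 C D hCA hDA hCD) hz)
    obtain ⟨x, w, hxw, hx⟩ := hCA.1.exists_arrow hp
    have hyx : y ≠ x := fun he => hy (he ▸ hx)
    obtain ⟨q, hq⟩ := hCA.1.exists_restr_eq hv hp
    rw [← restr_append, ← prod_induced] at hq
    obtain ⟨M, j, hM, hML, hMx⟩ := exists_induced_wordPow_eq (induced_lowDegree hL (v ++ q))
      (by rw [hq]; exact hxw)
    rw [hq] at hML
    obtain _ | k := k
    · refine absurd (hCA.1.isTrivialCycle ?_) hCA.2.2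
      rwa [← hML, List.prod_eq_one fun t ht => eq_one_of_mem_lowDegree_zero (hM t ht)] at hp
    · have hlow : ∀ t ∈ induced M [y], t ∈ lowDegree X k :=
        induced_lowDegree_of_ne (w := [x]) (z := w ++ wordPow (x :: w) j) hM hMx rfl (by simpa)
      have := ih k D (induced M [y]) hlow hnd.2 (fun E hE => hC E (List.mem_cons_of_mem _ hE)) hch
        ⟨r, by rw [prod_induced, hML, ← restr_cons, ← restr_append]; exact hz⟩
      simp only [List.length_cons]
      omega

/-- A polynomial state that is a product of states of low degree has low degree itself. -/
theorem prod_mem_lowDegree [Nontrivial X] {k : ℕ} {m : ℤ} {L : List (TreeAut X)}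
    (hL : ∀ s ∈ L, s ∈ lowDegree X k) (hm : L.prod ∈ Pol X m) : L.prod ∈ lowDegree X k := by
  obtain _ | k := k
  · exact Or.inl (List.prod_eq_one fun s hs => eq_one_of_mem_lowDegree_zero (hL s hs))
  obtain ⟨A, hA, -, hLA⟩ := hm
  refine Or.inr ⟨_, hA.states hLA, fun Cs hnd hCs hch => ?_, mem_states_self _⟩
  cases Cs with
  | nil => push_cast [List.length_nil]; omega
  | cons C Cs =>
    obtain ⟨s, hs⟩ := (hCs C (by simp)).1.nonempty_states
    obtain ⟨v, hv⟩ := (hCs C (by simp)).2.1 hs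
    have := length_chain_le (hA.states hLA) Cs (k + 1) C L hL hnd hCs hch ⟨v, by rw [hv]; exact hs⟩
    push_cast [List.length_cons]
    omega

/-! ### Passing to blocks of letters -/

/-- A common multiple of lengths of closed walks through the circuit states of a finite set. -/
theorem exists_common_period (T : Finset (TreeAut X)) :
    ∃ P : ℕ, 0 < P ∧ ∀ s ∈ T, s.IsCircuit → ∀ j, ∃ z : List X,
      z.length = P * j ∧ s.restr z = s := by
  classical
  induction T using Finset.induction_on with
  | empty => exact ⟨1, one_pos, by simp⟩
  | insert s T _ ih =>
    obtain ⟨P, hP, h⟩ := ih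
    by_cases hs : s.IsCircuit
    · obtain ⟨u, hu, hsu⟩ := hs
      refine ⟨u.length * P, Nat.mul_pos (List.length_pos_iff.2 hu) hP, ?_⟩
      simp only [Finset.mem_insert, forall_eq_or_imp]
      refine ⟨fun _ j => ⟨wordPow u (P * j), by rw [length_wordPow, mul_assoc],
        restr_wordPow hsu _⟩, fun t ht htc j => ?_⟩
      obtain ⟨z, hz, htz⟩ := h t ht htc (u.length * j)
      exact ⟨z, by rw [hz]; ring, htz⟩
    · refine ⟨P, hP, ?_⟩
      simp only [Finset.mem_insert, forall_eq_or_imp]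
      exact ⟨fun h' => absurd h' hs, h⟩

/-- Every finite self-similar set is normalized with respect to blocks of a suitable length. -/
theorem exists_isBlockNormalized {T : Set (TreeAut X)} (hfin : T.Finite) (hT : IsSelfSimilar T) :
    ∃ N, 0 < N ∧ IsBlockNormalized N T := by
  lift T to Finset (TreeAut X) using hfin
  obtain ⟨P, hP, h⟩ := exists_common_period T
  refine ⟨P * (T.card + 1), by positivity, hT, fun k s hs hk w hw => ?_⟩
  refine (isCircuit_or_of_card_le hT hs hk ?_).imp_left fun hc => h _ (hT s hs w) hc _
  rw [hw]
  nlinarith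

/-- A normalized set is normalized with respect to blocks that consist of a single letter. -/
theorem IsNormalized.isBlockNormalized [Nonempty X] {S : Set (TreeAut X)} (hS : IsNormalized S) :
    IsBlockNormalized 1 S := by
  obtain ⟨-, -, hself, hor, hloop⟩ := hS
  refine ⟨hself, fun k s hs hk w hw => ?_⟩
  obtain ⟨x, rfl⟩ := List.length_eq_one_iff.1 hw
  rcases hor s hs x with hc | ⟨d, e, hd, he, hde⟩
  · refine Or.inl ?_
    by_cases h1 : s.restr [x] = 1
    · exact ⟨[Classical.arbitrary X], rfl, by rw [h1, restr_one]⟩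
    · obtain ⟨z, hz⟩ := hloop _ (hself s hs _) h1 hc
      exact ⟨[z], rfl, hz⟩
  · rcases hk with rfl | hk
    · exact Or.inr (by rw [restr_one]; exact Or.inl rfl)
    · refine Or.inr (Or.inr (Pol_mono ?_ hd.1))
      have : ¬ ((k + 1 : ℕ) : ℤ) - 2 ≤ e - 1 := fun h => he.2 (Pol_mono h hk)
      push_cast at this
      omega

theorem exists_list_of_mem_closure {S : Set (TreeAut X)} {g : TreeAut X}
    (hg : g ∈ Subgroup.closure S) : ∃ L : List (TreeAut X), (∀ s ∈ L, s ∈ S ∪ S⁻¹) ∧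
      L.length = wordLength S g ∧ L.prod = g := by
  rw [← Subgroup.mem_toSubmonoid, Subgroup.closure_toSubmonoid] at hg
  obtain ⟨L, hL, hLg⟩ := Submonoid.exists_list_of_mem_closure hg
  exact Nat.sInf_mem (s := {n | ∃ L : List (TreeAut X), (∀ s ∈ L, s ∈ S ∪ S⁻¹) ∧
    L.length = n ∧ L.prod = g}) ⟨_, L, fun s hs => hL s hs, rfl, hLg⟩

end TreeAut

open TreeAut in
theorem lemma1 {X : Type*} [Finite X] [Nontrivial X] (m : ℤ) (hm : -1 ≤ m) :
    (∀ G : Subgroup (TreeAut X), (G : Set (TreeAut X)) ⊆ TreeAut.Pol X m →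
      ∀ S : Set (TreeAut X), S.Finite → Subgroup.closure S = G →
        ∃ C : ℝ, ∀ g ∈ G, ∀ v : List X,
          C * binLog (TreeAut.wordLength S g) ^ (m + 1) ≤ (v.length : ℝ) →
            (g.restr v).IsCircuit ∨ g.restr v ∈ TreeAut.Pol X (m - 1)) ∧
    (∀ S : Set (TreeAut X), TreeAut.IsNormalized S →
      (Subgroup.closure S : Set (TreeAut X)) ⊆ TreeAut.Pol X m →
        ∃ C : ℝ, ∀ L : List (TreeAut X), (∀ s ∈ L, s ∈ S) → ∀ v : List X,
          C * binLog L.length ^ (m + 1) ≤ (v.length : ℝ) →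
            (L.prod.restr v ∈ Subgroup.closure (S ∩ TreeAut.Pol X (m - 1)) ∧
              ∀ t ∈ TreeAut.induced L v, t ∈ S ∩ TreeAut.Pol X (m - 1)) ∨
            ((L.prod.restr v).IsCircuit ∧
              ∃ x : X, (L.prod.restr v).restr [x] = L.prod.restr v ∧
                TreeAut.induced L (v ++ [x]) = TreeAut.induced L v)) := by
  obtain ⟨k, hk⟩ : ∃ k : ℕ, m + 1 = k := ⟨(m + 1).toNat, by omega⟩
  have hPol : Pol X m ⊆ lowDegree X (k + 1) := fun g hg =>
    Or.inr (Pol_mono (by push_cast; omega) hg)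
  have hlow : ∀ {g : TreeAut X}, g ∈ lowDegree X k → g = 1 ∨ g ∈ Pol X (m - 1) := fun hg =>
    hg.imp_right fun h => Pol_mono (by omega) h
  have h1c : (1 : TreeAut X).IsCircuit := by
    obtain ⟨x⟩ : Nonempty X := inferInstance
    exact ⟨[x], by simp, restr_one _⟩
  simp only [hk, zpow_natCast]
  constructor
  · intro G hG S hSfin hSG
    have hSmem : ∀ s ∈ S ∪ S⁻¹, s ∈ Pol X m := by
      rintro s (hs | hs)
      · exact hG (hSG ▸ Subgroup.subset_closure hs)
      · exact hG (hSG ▸ (inv_mem_iff.1 (Subgroup.subset_closure hs)))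
    -- The restrictions of the generators form a finite self-similar set.
    set T : Set (TreeAut X) := ⋃ s ∈ S ∪ S⁻¹, s.states with hT
    have hTfin : T.Finite :=
      (hSfin.union hSfin.inv).biUnion fun s hs => finite_states (hSmem s hs)
    have hTself : IsSelfSimilar T := by
      intro t ht v
      simp only [hT, Set.mem_iUnion] at ht ⊢
      obtain ⟨s, hs, ht⟩ := ht
      exact ⟨s, hs, isSelfSimilar_states s t ht v⟩
    have hTk : T ⊆ lowDegree X (k + 1) := by
      intro t ht
      simp only [hT, Set.mem_iUnion] at ht
      obtain ⟨s, hs, v, rfl⟩ := ht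
      exact hPol (restr_mem_Pol (hSmem s hs) v)
    obtain ⟨N, hN, hTN⟩ := exists_isBlockNormalized hTfin hTself
    obtain ⟨C, hC⟩ := exists_settled hN hTN k hTk
    refine ⟨C, fun g hg v hv => ?_⟩
    obtain ⟨L, hLS, hLn, rfl⟩ := exists_list_of_mem_closure (hSG ▸ hg)
    rw [← hLn] at hv
    obtain ⟨v, u, rfl, -, hset⟩ := hC L
      (fun s hs => Set.mem_biUnion (hLS s hs) (mem_states_self s)) v hv
    have hgv : L.prod.restr v ∈ Pol X m := restr_mem_Pol (hG hg) v
    have hmem : (L.prod.restr (v ++ u)).IsCircuit ∨ L.prod.restr (v ++ u) ∈ lowDegree X k := by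
      rw [restr_append]
      rcases hset with hall | ⟨b, hb, hbe⟩
      · rw [← prod_induced] at hgv ⊢
        exact Or.inr (restr_mem_lowDegree (prod_mem_lowDegree hall hgv) u)
      · refine IsCircuit.restr_or (hPol hgv) (isCircuit_of_restr_eq hN hb ?_)
        rw [← prod_induced, restr_prod_of_induced_eq hbe]
    rcases hmem with h | h
    · exact Or.inl h
    · exact (hlow h).imp_left fun h1 => by rw [h1]; exact h1c
  · intro S hS hSG
    have hSk : S ⊆ lowDegree X (k + 1) := fun s hs => hPol (hSG (Subgroup.subset_closure hs))
    obtain ⟨C, hC⟩ := exists_settled one_pos hS.isBlockNormalized k hSk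
    refine ⟨C, fun L hL v hv => ?_⟩
    obtain ⟨v, u, rfl, hu, hset⟩ := hC L hL v hv
    obtain rfl : u = [] := List.length_eq_zero_iff.1 (by omega)
    rw [List.append_nil]
    have hLS := forall_mem_induced hS.2.2.1 hL v
    have hloop : ∀ x : X, induced (induced L v) [x] = induced L v →
        (L.prod.restr v).IsCircuit ∧ ∃ x : X, (L.prod.restr v).restr [x] = L.prod.restr v ∧
          induced L (v ++ [x]) = induced L v := fun x hx => by
      have h := restr_prod_of_induced_eq hx
      rw [prod_induced] at h
      exact ⟨⟨[x], by simp, h⟩, x, h, by rw [induced_append_right, hx]⟩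
    rcases hset with hall | ⟨b, hb, hbe⟩
    · obtain _ | k := k
      -- For `m = -1` all factors are trivial, and every letter fixes them.
      · obtain ⟨x⟩ : Nonempty X := inferInstance
        exact Or.inr (hloop x (induced_eq_of_lowDegree_zero hall [x]))
      · have h1 : (1 : TreeAut X) ∈ Pol X (m - 1) := one_mem_Pol (by omega)
        have hmem : ∀ t ∈ induced L v, t ∈ S ∩ Pol X (m - 1) := fun t ht =>
          ⟨hLS t ht, (hlow (hall t ht)).elim (fun h => h ▸ h1) id⟩
        refine Or.inl ⟨?_, hmem⟩
        rw [← prod_induced]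
        exact Subgroup.list_prod_mem _ fun t ht => Subgroup.subset_closure (hmem t ht)
    · obtain ⟨x, rfl⟩ := List.length_eq_one_iff.1 hb
      exact Or.inr (hloop x hbe)
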